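/- Consider $K$ users with transmit powers $p_k\ge 0$, inverse amplifier efficiencies $\mu_k\ge 0$ and channels $h_k\in\mathbb C^N$ to a reconfigurable intelligent surface (RIS) with reflection vector $\gamma\in\mathbb C^N$; let $G_B\in\mathbb C^{N_B\times N}$ be the channel from the RIS to the receiver (Bob), $\hat g_E\in\mathbb C^N$ the mean of the channel from the RIS to the eavesdropper (Eve), $\sigma_g^2\ge 0$ the variance of that channel, $\sigma_B^2,\sigma_E^2,\sigma_{RIS}^2>0$ the noise variances, $c_k\in\mathbb C^{N_B}$ the fixed receive filters, $B>0$ the bandwidth, $P_c=NP_{c,n}+P_0^{RIS}+P_0>0$ the static power and $P_{R,\max}>0$ the maximum RIS power. Put $H_k=\mathrm{diag}(h_k)$, $A_k=G_BH_k$, $\Gamma=\mathrm{diag}(\gamma)$, $W_B=\sigma_B^2I+\sigma_{RIS}^2G_B\Gamma\Gamma^HG_B^H$, $R_E=\hat g_E\hat g_E^H+\sigma_g^2I$, $R=\sum_kp_kH_k^HH_k+\sigma_{RIS}^2I$, $P_{c,eq}=\sum_kp_k\mu_k+P_c-\mathrm{tr}(R)$, $$\mathrm{SINR}_{k,B}=\frac{p_k|c_k^HA_k\gamma|^2}{c_k^HW_Bc_k+\sum_{m\ne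 k}p_m|c_k^HA_m\gamma|^2},\qquad \widetilde{\mathrm{SINR}}_{k,E}=\frac{p_k\|R_E^{1/2}H_k\gamma\|^2}{\sum_{m\ne k}p_m\|R_E^{1/2}H_m\gamma\|^2+\sigma_{RIS}^2\|R_E^{1/2}\gamma\|^2+\sigma_E^2}$$ (with $\mathrm{SINR}_{k,B}=0$ if $c_k=0$). The RIS subproblem is $$\max_\gamma\ F(\gamma)=B\,\frac{\sum_k\log_2(1+\mathrm{SINR}_{k,B})-\log_2(1+\widetilde{\mathrm{SINR}}_{k,E})}{\mathrm{tr}(R\gamma\gamma^H)+P_{c,eq}}\quad\text{s.t.}\quad \mathrm{tr}(R)\le\mathrm{tr}(R\gamma\gamma^H)\le P_{R,\max}+\mathrm{tr}(R).$$ Let $x_{B}=p_k|c_k^HA_k\gamma|^2$, $y_{B}=c_k^HW_Bc_k+\sum_{m\ne k}p_m|c_k^HA_m\gamma|^2$, $x_E=p_k\|R_E^{1/2}H_k\gamma\|^2$, $y_E=\sum_{m\ne k}p_m\|R_E^{1/2}H_m\gamma\|^2+\sigma_{RIS}^2\|R_E^{1/2}\gamma\|^2$ (all depending on $k$), let a bar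 denote values at a vector $\bar\gamma$, and let $T_B,T_E$ be the first-order Taylor expansions of $\sqrt{x_B},\sqrt{y_E}$ around $\bar\gamma$. Define $$\widetilde{SR}_k=\log_2\Big(1+\frac{\bar x_B}{\bar y_B}\Big)+\frac1{\ln2}\frac{\bar x_B}{\bar y_B}\Big(\frac{2T_B}{\sqrt{\bar x_B}}-\frac{x_B+y_B}{\bar x_B+\bar y_B}-1\Big)+\log_2\Big(1+\frac{\bar y_E}{\sigma_E^2}\Big)+\frac1{\ln2}\frac{\bar y_E}{\sigma_E^2}\Big(\frac{2T_E}{\sqrt{\bar y_E}}-\frac{y_E+\sigma_E^2}{\bar y_E+\sigma_E^2}-1\Big)+\log_2\frac{\sigma_E^2}{\sigma_E^2+\bar x_E+\bar y_E}-\frac1{\ln2}\frac{x_E+y_E-\bar x_E-\bar y_E}{\sigma_E^2+\bar x_E+\bar y_E},$$ where a term with the factor $\bar x_B/\bar y_B$ or $\bar y_E/\sigma_E^2$ is omitted if $\bar x_B=0$ or $\bar y_E=0$, respectively, and $\bar x_B/\bar y_B$ is read as $0$ if $c_k=0$. The surrogate problem around $\bar\gamma$ is $$\max_\gamma\ \frac{\sum_k\widetilde{SR}_k}{\mathrm{tr}(R\gamma\gamma^H)+P_{c,eq}}\quad\text{s.t.}\quad\gamma^HR\gamma\le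 P_{R,\max}+\mathrm{tr}(R),\quad\bar\gamma^HR\bar\gamma+2\Re\{\bar\gamma^HR(\gamma-\bar\gamma)\}\ge\mathrm{tr}(R).$$ The algorithm starts at any feasible $\gamma^{(0)}$, takes as $\gamma^{(n+1)}$ a (global) solution of the surrogate problem around $\gamma^{(n)}$, and stops with output $\gamma^{(n+1)}$ as soon as $\|\gamma^{(n+1)}-\gamma^{(n)}\|<\epsilon$. Then a feasible starting vector exists, every surrogate problem around a feasible vector has a solution, and for every sequence $(\gamma^{(n)})$ of iterates: all iterates are feasible; $F(\gamma^{(n)})$ is nondecreasing, with $F(\gamma^{(n)})<F(\gamma^{(n+1)})$ unless $\gamma^{(n)}$ is a KKT point of the RIS subproblem; $F(\gamma^{(n)})$ converges to some $L\in\mathbb R$; the iterates have a limit point, and every limit point is a KKT point of the RIS subproblem at which $F$ equals $L$; the distance of $\gamma^{(n)}$ to the set of KKT points tends to $0$; and for every $\delta>0$ there is $\epsilon_0>0$ such that, if the algorithm with a tolerance $\epsilon\le\epsilon_0$ stops, its output is at distance less than $\delta$ from a KKT point. If moreover $F(\gamma^{(n)})>0$ for some $n$, then $\|\gamma^{(n+1)}-\gamma^{(n)}\|\to0$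 and the algorithm stops for every $\epsilon>0$. -/

import Mathlib

open Filter Topology Matrix

noncomputable section

/-- First-order Taylor expansion, around `x₀`, of a real-valued function on a real normed space. -/
def firstOrderTaylor {E : Type*} [NormedAddCommGroup E] [NormedSpace ℝ E]
    (f : E → ℝ) (x₀ x : E) : ℝ :=
  f x₀ + fderiv ℝ f x₀ (x - x₀)

/-- Karush-Kuhn-Tucker points of the problem: maximize `f x` subject to `g i x ≤ 0` for all `i`.
The space is regarded as a real normed space. -/
structure IsKKTPoint {E : Type*} [NormedAddCommGroup E] [NormedSpace ℝ E]
    {ι : Type*} [Fintype ι] (f : E → ℝ) (g : ι → E → ℝ) (x : E) : Prop where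
  differentiableAt_objective : DifferentiableAt ℝ f x
  differentiableAt_constraint : ∀ i, DifferentiableAt ℝ (g i) x
  feasible : ∀ i, g i x ≤ 0
  multipliers : ∃ l : ι → ℝ, (∀ i, 0 ≤ l i) ∧ (∀ i, l i * g i x = 0) ∧
    fderiv ℝ f x = ∑ i, l i • fderiv ℝ (g i) x

/-- The (real part of the) Hermitian form `vᴴ M v`. If `M` is positive semidefinite this is
`‖M^{1/2} v‖²`. -/
def hermForm {N : ℕ} (M : Matrix (Fin N) (Fin N) ℂ) (v : Fin N → ℂ) : ℝ :=
  (star v ⬝ᵥ (M *ᵥ v)).re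

/-- The data of the RIS subproblem: `K` users, `N` reflecting elements, `NB` antennas at Bob.
The transmit powers `p` and the receive filters `c` are fixed. -/
structure RISNetwork (K N NB : ℕ) where
  /-- bandwidth -/
  B : ℝ
  /-- transmit powers of the users -/
  p : Fin K → ℝ
  /-- inverse efficiencies of the transmit amplifiers -/
  mu : Fin K → ℝ
  /-- channels from the users to the RIS -/
  h : Fin K → Fin N → ℂ
  /-- channel from the RIS to Bob -/
  G : Matrix (Fin NB) (Fin N) ℂ
  /-- mean of the channel from the RIS to Eve -/
  gHat : Fin N → ℂ
  /-- receive filters at Bob -/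
  c : Fin K → Fin NB → ℂ
  /-- noise variance at Bob -/
  varB : ℝ
  /-- noise variance at Eve -/
  varE : ℝ
  /-- noise variance at the RIS -/
  varRIS : ℝ
  /-- variance of the channel from the RIS to Eve around its mean -/
  varG : ℝ
  /-- static power consumption of each RIS element -/
  Pcn : ℝ
  /-- remaining static power consumption of the RIS -/
  P0RIS : ℝ
  /-- all other static power consumption -/
  P0 : ℝ
  /-- maximum radio-frequency power of the RIS amplifier -/
  PRmax : ℝ

namespace RISNetwork

variable {K N NB : ℕ} (S : RISNetwork K N NB)

/-- `H_k = diag(h_k)`. -/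
def H (k : Fin K) : Matrix (Fin N) (Fin N) ℂ := Matrix.diagonal (S.h k)

/-- `A_k = G_B H_k`. -/
def A (k : Fin K) : Matrix (Fin NB) (Fin N) ℂ := S.G * S.H k

/-- `|c_kᴴ A_m γ|²`. -/
def gainB (k m : Fin K) (γ : EuclideanSpace ℂ (Fin N)) : ℝ :=
  ‖star (S.c k) ⬝ᵥ (S.A m *ᵥ γ.ofLp)‖ ^ 2

/-- Noise covariance matrix at Bob,
`W_B = σ_B² I + σ_RIS² G_B Γ Γᴴ G_Bᴴ` with `Γ = diag(γ)`. -/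
def WB (γ : EuclideanSpace ℂ (Fin N)) : Matrix (Fin NB) (Fin NB) ℂ :=
  (S.varB : ℂ) • (1 : Matrix (Fin NB) (Fin NB) ℂ) +
    (S.varRIS : ℂ) •
      (S.G * Matrix.diagonal γ.ofLp * (Matrix.diagonal γ.ofLp)ᴴ * S.Gᴴ)

/-- SINR of user `k` at Bob. -/
def sinrB (k : Fin K) (γ : EuclideanSpace ℂ (Fin N)) : ℝ :=
  S.p k * S.gainB k k γ /
    (hermForm (S.WB γ) (S.c k) + ∑ m ∈ Finset.univ.erase k, S.p m * S.gainB k m γ)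

/-- `R_E = ĝ_E ĝ_Eᴴ + σ_g² I`. -/
def RE : Matrix (Fin N) (Fin N) ℂ :=
  Matrix.vecMulVec S.gHat (star S.gHat) + (S.varG : ℂ) • (1 : Matrix (Fin N) (Fin N) ℂ)

/-- `‖R_E^{1/2} H_m γ‖²`. -/
def gainE (m : Fin K) (γ : EuclideanSpace ℂ (Fin N)) : ℝ :=
  hermForm S.RE (S.H m *ᵥ γ.ofLp)

/-- Approximate SINR of user `k` at Eve. -/
def sinrE (k : Fin K) (γ : EuclideanSpace ℂ (Fin N)) : ℝ :=
  S.p k * S.gainE k γ /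
    ((∑ m ∈ Finset.univ.erase k, S.p m * S.gainE m γ) +
      S.varRIS * hermForm S.RE γ.ofLp + S.varE)

/-- `R = ∑_k p_k H_kᴴ H_k + σ_RIS² I`. -/
def R : Matrix (Fin N) (Fin N) ℂ :=
  (∑ k, (S.p k : ℂ) • ((S.H k)ᴴ * S.H k)) +
    (S.varRIS : ℂ) • (1 : Matrix (Fin N) (Fin N) ℂ)

/-- `tr(R)`. -/
def trR : ℝ := S.R.trace.re

/-- `tr(R γ γᴴ)`. -/
def trRγ (γ : EuclideanSpace ℂ (Fin N)) : ℝ :=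
  (S.R * Matrix.vecMulVec γ.ofLp (star γ.ofLp)).trace.re

/-- Static power `P_c = N P_{c,n} + P_0^RIS + P_0`. -/
def Pc : ℝ := N * S.Pcn + S.P0RIS + S.P0

/-- `P_{c,eq} = ∑_k p_k μ_k + P_c - tr(R)`. -/
def Pceq : ℝ := (∑ k, S.p k * S.mu k) + S.Pc - S.trR

/-- Total power consumption as a function of `γ`. -/
def power (γ : EuclideanSpace ℂ (Fin N)) : ℝ := S.trRγ γ + S.Pceq

/-- Objective of the RIS subproblem: the approximate secrecy energy efficiency. -/
def see (γ : EuclideanSpace ℂ (Fin N)) : ℝ :=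
  S.B * ((∑ k, (Real.logb 2 (1 + S.sinrB k γ) - Real.logb 2 (1 + S.sinrE k γ))) / S.power γ)

/-- The two constraints `tr(R) ≤ tr(R γ γᴴ)` and `tr(R γ γᴴ) ≤ P_{R,max} + tr(R)` of the RIS
subproblem, in the form `g i γ ≤ 0`. -/
def constraint : Fin 2 → EuclideanSpace ℂ (Fin N) → ℝ :=
  ![fun γ => S.trR - S.trRγ γ, fun γ => S.trRγ γ - (S.PRmax + S.trR)]

/-- Feasible vectors of the RIS subproblem. -/
def IsFeasible (γ : EuclideanSpace ℂ (Fin N)) : Prop :=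
  S.trR ≤ S.trRγ γ ∧ S.trRγ γ ≤ S.PRmax + S.trR

/-- KKT points of the RIS subproblem. -/
def IsKKT (γ : EuclideanSpace ℂ (Fin N)) : Prop :=
  IsKKTPoint S.see S.constraint γ

/-! The surrogate problem. -/

/-- `x_B = p_k |c_kᴴ A_k γ|²`. -/
def xB (k : Fin K) (γ : EuclideanSpace ℂ (Fin N)) : ℝ := S.p k * S.gainB k k γ

/-- `y_B = σ_B² ‖c_k‖² + σ_RIS² ‖U_k^{1/2} γ‖² + ∑_{m ≠ k} p_m |c_kᴴ A_m γ|²`, where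
`U_k = diag(|u_{k,1}|², …, |u_{k,N}|²)` and `u_k = G_Bᴴ c_k`. -/
def yB (k : Fin K) (γ : EuclideanSpace ℂ (Fin N)) : ℝ :=
  S.varB * (∑ i, ‖S.c k i‖ ^ 2) +
    S.varRIS * (∑ n, ‖(S.Gᴴ *ᵥ S.c k) n‖ ^ 2 * ‖γ n‖ ^ 2) +
    ∑ m ∈ Finset.univ.erase k, S.p m * S.gainB k m γ

/-- `x_E = p_k ‖R_E^{1/2} H_k γ‖²`. -/
def xE (k : Fin K) (γ : EuclideanSpace ℂ (Fin N)) : ℝ := S.p k * S.gainE k γ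

/-- `y_E = ∑_{m ≠ k} p_m ‖R_E^{1/2} H_m γ‖² + σ_RIS² ‖R_E^{1/2} γ‖²`. -/
def yE (k : Fin K) (γ : EuclideanSpace ℂ (Fin N)) : ℝ :=
  (∑ m ∈ Finset.univ.erase k, S.p m * S.gainE m γ) + S.varRIS * hermForm S.RE γ.ofLp

/-- Concave lower bound, around `γ₀`, of the approximate secrecy rate of user `k`: logarithmic
lower bounds (the factor `1 / log 2` is due to the base-two logarithm), in which `√x_B` and `√y_E`
are replaced by their first-order Taylor expansions around `γ₀`. If `x_B` or `y_E` vanishes at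
`γ₀`, the corresponding expansion has the coefficient zero. -/
def surrogateRate (k : Fin K) (γ₀ γ : EuclideanSpace ℂ (Fin N)) : ℝ :=
  Real.logb 2 (1 + S.xB k γ₀ / S.yB k γ₀) +
    1 / Real.log 2 * (S.xB k γ₀ / S.yB k γ₀ *
      (2 * firstOrderTaylor (fun v => √(S.xB k v)) γ₀ γ / √(S.xB k γ₀)
        - (S.xB k γ + S.yB k γ) / (S.xB k γ₀ + S.yB k γ₀) - 1)) +
  (Real.logb 2 (1 + S.yE k γ₀ / S.varE) +
    1 / Real.log 2 * (S.yE k γ₀ / S.varE *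
      (2 * firstOrderTaylor (fun v => √(S.yE k v)) γ₀ γ / √(S.yE k γ₀)
        - (S.yE k γ + S.varE) / (S.yE k γ₀ + S.varE) - 1))) +
  (Real.logb 2 (S.varE / (S.varE + S.xE k γ₀ + S.yE k γ₀)) -
    1 / Real.log 2 * ((S.xE k γ + S.yE k γ - S.xE k γ₀ - S.yE k γ₀) /
      (S.varE + S.xE k γ₀ + S.yE k γ₀)))

/-- Objective of the surrogate problem around `γ₀`. -/
def surrogate (γ₀ γ : EuclideanSpace ℂ (Fin N)) : ℝ :=
  (∑ k, S.surrogateRate k γ₀ γ) / S.power γ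

/-- Feasible vectors of the surrogate problem around `γ₀`: `γᴴ R γ ≤ P_{R,max} + tr(R)` and
`γ₀ᴴ R γ₀ + 2 Re(γ₀ᴴ R (γ - γ₀)) ≥ tr(R)`. -/
def IsSurrogateFeasible (γ₀ γ : EuclideanSpace ℂ (Fin N)) : Prop :=
  hermForm S.R γ.ofLp ≤ S.PRmax + S.trR ∧
    S.trR ≤ hermForm S.R γ₀.ofLp + 2 * (star γ₀.ofLp ⬝ᵥ (S.R *ᵥ (γ - γ₀).ofLp)).re

/-- `γ` is a (global) solution of the surrogate problem around `γ₀`. -/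
def IsSurrogateSolution (γ₀ γ : EuclideanSpace ℂ (Fin N)) : Prop :=
  S.IsSurrogateFeasible γ₀ γ ∧
    ∀ v, S.IsSurrogateFeasible γ₀ v → S.surrogate γ₀ v ≤ S.surrogate γ₀ γ

/-- The iterates of the algorithm: it starts at any feasible vector, and each iterate is a solution
of the surrogate problem around the previous one. -/
def IsRun (γ : ℕ → EuclideanSpace ℂ (Fin N)) : Prop :=
  S.IsFeasible (γ 0) ∧ ∀ n, S.IsSurrogateSolution (γ n) (γ (n + 1))

end RISNetwork

/-- The stopping rule with tolerance `ε` is met for the first time when `γ (n + 1)` has been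
computed from `γ n`; the output of the algorithm is then `γ (n + 1)`. -/
def StopsAt {E : Type*} [NormedAddCommGroup E] (γ : ℕ → E) (ε : ℝ) (n : ℕ) : Prop :=
  ‖γ (n + 1) - γ n‖ < ε ∧ ∀ m < n, ε ≤ ‖γ (m + 1) - γ m‖

end

/-! The algorithm is a minorize-maximize scheme. All the powers involved are squared seminorms of
`γ`, plus constants. For such data each rate has a jointly continuous concave minorant around `v₀`
that touches it at `v₀`: `log t ≤ t - 1` handles the logarithms, and Cauchy-Schwarz lets the Taylor
expansion of a seminorm stand in for it (`isConcaveMinorant_logRatioMinorant`,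
`isConcaveMinorant_logb_div`). The linearized lower power constraint is a tangent to a convex
function, so surrogate-feasible points are feasible. The rest of the argument uses only this
structure, axiomatized in `SurrogateModel`.

A surrogate solution does at least as well as every surrogate-feasible competitor
(`IsSurSolution.mul_sur_le_obj`). Competing with the current point gives monotonicity. Since
objective and surrogate agree to first order at the current point and Slater's condition holds, a
point whose own surrogate cannot be improved is a KKT point (`IsFeasible.isKKT`); hence the strict
increase elsewhere. If the surrogate at a limit point could be improved, the same competitor would
lift a later iterate above the limit of the objective, so limit points are KKT points
(`IsRun.isKKT_of_mapClusterPt`). Compactness then gives the distance statements.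

Once the objective is positive, the power in the denominator acts as a strongly convex penalty, and
each step gains a multiple of its squared length (`IsSurSolution.obj_add_le`). The gains tend to
zero, hence so do the steps. -/

noncomputable section

/-! ### Positive semidefinite quadratic functions and their seminorms -/

/-- A positive semidefinite symmetric continuous bilinear form on a real normed space. -/
structure IsPSDForm {E : Type*} [NormedAddCommGroup E] [NormedSpace ℝ E]
    (b : E →L[ℝ] E →L[ℝ] ℝ) : Prop where
  symm : ∀ u v, b u v = b v u
  nonneg : ∀ v, 0 ≤ b v v

/-- Quadratic functions that come from a positive semidefinite bilinear form. -/
def IsPSDQuadratic {E : Type*} [NormedAddCommGroup E] [NormedSpace ℝ E] (q : E → ℝ) : Prop :=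
  ∃ b : E →L[ℝ] E →L[ℝ] ℝ, IsPSDForm b ∧ ∀ v, q v = b v v

section PSD

variable {E : Type*} [NormedAddCommGroup E] [NormedSpace ℝ E]

namespace IsPSDForm

variable {b : E →L[ℝ] E →L[ℝ] ℝ} (hb : IsPSDForm b)
include hb

/-- The quadratic `t ↦ b (t • u + v) (t • u + v)` is nonnegative, so its discriminant is
nonpositive; definiteness is not needed. -/
theorem sq_le (u v : E) : b u v ^ 2 ≤ b u u * b v v := by
  have key : ∀ t : ℝ, 0 ≤ b u u * (t * t) + 2 * b u v * t + b v v := fun t => by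
    have h := hb.nonneg (t • u + v)
    simp only [map_add, map_smul, _root_.add_apply, _root_.smul_apply,
      smul_eq_mul, hb.symm v u] at h
    linarith
  have := discrim_le_zero key
  rw [discrim] at this
  nlinarith

theorem apply_le_sqrt_mul_sqrt (u v : E) : b u v ≤ √(b u u) * √(b v v) := by
  rw [← Real.sqrt_mul (hb.nonneg u)]
  exact Real.le_sqrt_of_sq_le (hb.sq_le u v)

theorem apply_eq_zero {u : E} (hu : b u u = 0) (v : E) : b u v = 0 := by
  have h := hb.sq_le u v
  rw [hu, zero_mul] at h
  exact pow_eq_zero_iff two_ne_zero |>.1 (le_antisymm h (sq_nonneg _))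

theorem apply_add_smul (x d : E) (t : ℝ) :
    b (x + t • d) (x + t • d) = b x x + t * (2 * b x d) + t ^ 2 * b d d := by
  simp only [map_add, map_smul, _root_.add_apply, _root_.smul_apply, smul_eq_mul, hb.symm d x]
  ring

/-- The parallelogram law. The defect `4⁻¹ * b (v - u) (v - u)` is the source of the strong
concavity estimate. -/
theorem apply_midpoint (u v : E) :
    b ((2⁻¹ : ℝ) • (u + v)) ((2⁻¹ : ℝ) • (u + v)) =
      2⁻¹ * (b u u + b v v) - 4⁻¹ * b (v - u) (v - u) := by
  simp only [map_add, map_sub, map_smul, _root_.add_apply, _root_.sub_apply, _root_.smul_apply,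
    smul_eq_mul, hb.symm v u]
  ring

theorem tangent_le (u v : E) : b u u + 2 * b u (v - u) ≤ b v v := by
  have h := hb.nonneg (v - u)
  simp only [map_sub, _root_.sub_apply, hb.symm v u] at h ⊢
  linarith

theorem hasFDerivAt (x : E) : HasFDerivAt (fun v => b v v) ((2 : ℝ) • b x) x := by
  have h := b.hasFDerivAt_of_bilinear (hasFDerivAt_id x) (hasFDerivAt_id x)
  refine h.congr_fderiv ?_
  ext d
  simp [hb.symm d x]
  ring

/-- The first-order Taylor expansion of the seminorm `√(b v v)`. -/
theorem firstOrderTaylor_sqrt {x : E} (hx : 0 < b x x) (v : E) :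
    firstOrderTaylor (fun v => √(b v v)) x v = b x v / √(b x x) := by
  have h := (hb.hasFDerivAt x).sqrt hx.ne'
  have hs := Real.sqrt_pos.2 hx
  rw [firstOrderTaylor, h.fderiv]
  simp only [_root_.smul_apply, smul_eq_mul, map_sub]
  -- By homogeneity, the constant `√(b x x)` cancels the derivative term `b x x / √(b x x)`.
  have h2 := Real.mul_self_sqrt hx.le
  field_simp
  linarith

end IsPSDForm

theorem isPSDQuadratic_zero : IsPSDQuadratic (fun _ : E => (0 : ℝ)) :=
  ⟨0, ⟨by simp, by simp⟩, by simp⟩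

theorem IsPSDQuadratic.add {q₁ q₂ : E → ℝ} (h₁ : IsPSDQuadratic q₁) (h₂ : IsPSDQuadratic q₂) :
    IsPSDQuadratic (fun v => q₁ v + q₂ v) := by
  obtain ⟨b₁, hb₁, e₁⟩ := h₁
  obtain ⟨b₂, hb₂, e₂⟩ := h₂
  refine ⟨b₁ + b₂, ⟨fun u v => ?_, fun v => ?_⟩, fun v => ?_⟩
  · simp [hb₁.symm u v, hb₂.symm u v]
  · simpa using add_nonneg (hb₁.nonneg v) (hb₂.nonneg v)
  · simp [e₁, e₂]

theorem IsPSDQuadratic.const_mul {q : E → ℝ} (h : IsPSDQuadratic q) {c : ℝ} (hc : 0 ≤ c) :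
    IsPSDQuadratic (fun v => c * q v) := by
  obtain ⟨b, hb, e⟩ := h
  refine ⟨c • b, ⟨fun u v => ?_, fun v => ?_⟩, fun v => ?_⟩
  · simp [hb.symm u v]
  · simpa using mul_nonneg hc (hb.nonneg v)
  · simp [e]

theorem IsPSDQuadratic.sum {ι : Type*} (s : Finset ι) {q : ι → E → ℝ}
    (h : ∀ i, IsPSDQuadratic (q i)) : IsPSDQuadratic (fun v => ∑ i ∈ s, q i v) := by
  classical
  induction s using Finset.induction_on with
  | empty => simpa using isPSDQuadratic_zero
  | insert i s hi ih => simpa only [Finset.sum_insert hi] using (h i).add ih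

theorem IsPSDQuadratic.norm_sq {F : Type*} [NormedAddCommGroup F] [InnerProductSpace ℝ F]
    (T : E →L[ℝ] F) : IsPSDQuadratic (fun v => ‖T v‖ ^ 2) :=
  ⟨(innerSL ℝ).bilinearComp T T,
    ⟨fun u v => by simpa using real_inner_comm _ _, fun v => by simp⟩,
    fun v => by simp⟩

end PSD

/-! ### The scalar logarithmic inequality -/

/-- Apply `log t ≤ t - 1` to the quotient of `(x₀ + y₀) / y₀` by `(x + y) / y`. The resulting bound
exceeds the claimed one by a square over a positive denominator, which vanishes at `(x₀, y₀)`. -/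
theorem log_one_add_div_ge {x y x₀ y₀ : ℝ} (hx : 0 ≤ x) (hy : 0 < y) (hx₀ : 0 ≤ x₀)
    (hy₀ : 0 < y₀) :
    Real.log (1 + x₀ / y₀) +
      (2 * (√x₀ * √x) / y₀ - x₀ / y₀ * ((x + y) / (x₀ + y₀)) - x₀ / y₀) ≤
        Real.log (1 + x / y) := by
  have hs : 0 < x + y := by linarith
  have hs₀ : 0 < x₀ + y₀ := by linarith
  have h1 : Real.log ((x₀ + y₀) / y₀) - Real.log ((x + y) / y) ≤
      (x₀ + y₀) / y₀ * (y / (x + y)) - 1 := by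
    rw [← Real.log_div (by positivity) (by positivity)]
    refine (Real.log_le_sub_one_of_pos (by positivity)).trans (le_of_eq ?_)
    field_simp
  have e₀ : 1 + x₀ / y₀ = (x₀ + y₀) / y₀ := by field_simp; ring
  have e : 1 + x / y = (x + y) / y := by field_simp; ring
  rw [e₀, e]
  have h2 : 2 * (√x₀ * √x) / y₀ - x₀ / y₀ * ((x + y) / (x₀ + y₀)) - x₀ / y₀ ≤
      1 - (x₀ + y₀) / y₀ * (y / (x + y)) := by
    have a := Real.sq_sqrt hx
    have a₀ := Real.sq_sqrt hx₀
    have : 1 - (x₀ + y₀) / y₀ * (y / (x + y)) -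
        (2 * (√x₀ * √x) / y₀ - x₀ / y₀ * ((x + y) / (x₀ + y₀)) - x₀ / y₀) =
        (√x * (x₀ + y₀) - √x₀ * (x + y)) ^ 2 / (y₀ * (x + y) * (x₀ + y₀)) := by
      have : (√x * (x₀ + y₀) - √x₀ * (x + y)) ^ 2 =
          x * (x₀ + y₀) ^ 2 - 2 * (√x₀ * √x) * (x₀ + y₀) * (x + y) + x₀ * (x + y) ^ 2 := by
        rw [← a, ← a₀]; simp only [Real.sqrt_sq (Real.sqrt_nonneg _)]; ring
      rw [this]
      field_simp
      ring
    have h3 : 0 ≤ (√x * (x₀ + y₀) - √x₀ * (x + y)) ^ 2 / (y₀ * (x + y) * (x₀ + y₀)) := by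
      positivity
    linarith
  linarith


/-! ### Minorize-maximize for a fractional program -/

/-- `s x` is a (midpoint) concave minorant of `r` that touches `r` at `x`, and `s` is jointly
continuous. -/
structure IsConcaveMinorant {E : Type*} [NormedAddCommGroup E] [NormedSpace ℝ E]
    (r : E → ℝ) (s : E → E → ℝ) : Prop where
  continuous : Continuous (Function.uncurry s)
  le : ∀ x v, s x v ≤ r v
  self : ∀ x, s x x = r x
  differentiable : Differentiable ℝ r
  differentiableAt : ∀ x, DifferentiableAt ℝ (s x) x
  midpoint : ∀ x u v, 2⁻¹ * (s x u + s x v) ≤ s x ((2⁻¹ : ℝ) • (u + v))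

/-- A fractional program: maximize `B * (rate v / (quad v + C))` subject to
`τ ≤ quad v ≤ P + τ` for a coercive quadratic function `quad`, with a jointly continuous concave
minorant `minor x` of `rate` that touches `rate` at `x`. -/
structure SurrogateModel (E : Type*) [NormedAddCommGroup E] [NormedSpace ℝ E] where
  (B C τ P m : ℝ)
  quad : E → ℝ
  rate : E → ℝ
  minor : E → E → ℝ
  form : E →L[ℝ] E →L[ℝ] ℝ
  B_pos : 0 < B
  power_pos : 0 < τ + C
  P_pos : 0 < P
  m_pos : 0 < m
  psd : IsPSDForm form
  quad_eq : ∀ v, quad v = form v v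
  coercive : ∀ v, m * ‖v‖ ^ 2 ≤ quad v
  pos_or_subsingleton : 0 < τ ∨ Subsingleton E
  minorant : IsConcaveMinorant rate minor

namespace SurrogateModel

variable {E : Type*} [NormedAddCommGroup E] [NormedSpace ℝ E] (M : SurrogateModel E)

def obj (v : E) : ℝ := M.B * (M.rate v / (M.quad v + M.C))

def sur (x v : E) : ℝ := M.minor x v / (M.quad v + M.C)

def constr : Fin 2 → E → ℝ :=
  ![fun v => M.τ - M.quad v, fun v => M.quad v - (M.P + M.τ)]

def IsFeasible (v : E) : Prop := M.τ ≤ M.quad v ∧ M.quad v ≤ M.P + M.τ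

def IsSurFeasible (x v : E) : Prop :=
  M.quad v ≤ M.P + M.τ ∧ M.τ ≤ M.quad x + 2 * M.form x (v - x)

def IsSurSolution (x v : E) : Prop :=
  M.IsSurFeasible x v ∧ ∀ w, M.IsSurFeasible x w → M.sur x w ≤ M.sur x v

def IsRun (γ : ℕ → E) : Prop := M.IsFeasible (γ 0) ∧ ∀ n, M.IsSurSolution (γ n) (γ (n + 1))

def IsKKT (x : E) : Prop := IsKKTPoint M.obj M.constr x

variable {M}

theorem IsFeasible.isSurFeasible_self {x : E} (hx : M.IsFeasible x) : M.IsSurFeasible x x :=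
  ⟨hx.2, by simpa using hx.1⟩

/-- A convex quadratic lies above its tangent at `x`, so linearizing the reverse-convex constraint
shrinks the feasible set. -/
theorem IsSurFeasible.isFeasible {x v : E} (h : M.IsSurFeasible x v) : M.IsFeasible v :=
  ⟨h.2.trans (by simpa only [M.quad_eq] using M.psd.tangent_le x v), h.1⟩

theorem IsFeasible.power_pos {x : E} (hx : M.IsFeasible x) : 0 < M.quad x + M.C := by
  linarith [M.power_pos, hx.1]

theorem IsSurSolution.isFeasible {x v : E} (h : M.IsSurSolution x v) : M.IsFeasible v :=
  h.1.isFeasible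

variable (M)

theorem hasFDerivAt_quad (x : E) : HasFDerivAt M.quad ((2 : ℝ) • M.form x) x := by
  rw [funext M.quad_eq]
  exact M.psd.hasFDerivAt x

theorem continuous_quad : Continuous M.quad :=
  continuous_iff_continuousAt.2 fun x => (M.hasFDerivAt_quad x).continuousAt

theorem obj_self (x : E) : M.B * M.sur x x = M.obj x := by
  rw [sur, obj, M.minorant.self]

theorem mul_sur_le_obj (x : E) {v : E} (hv : 0 < M.quad v + M.C) :
    M.B * M.sur x v ≤ M.obj v := by
  have := M.B_pos
  have := M.minorant.le x v
  rw [sur, obj]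
  gcongr

variable {M}

theorem IsFeasible.differentiableAt_div_power {x : E} (hx : M.IsFeasible x) {f : E → ℝ}
    (hf : DifferentiableAt ℝ f x) : DifferentiableAt ℝ (fun v => f v / (M.quad v + M.C)) x := by
  have hp : DifferentiableAt ℝ (fun v => M.quad v + M.C) x :=
    (M.hasFDerivAt_quad x).differentiableAt.add_const M.C
  simpa only [div_eq_mul_inv] using hf.fun_mul (hp.fun_inv hx.power_pos.ne')

theorem IsFeasible.differentiableAt_obj {x : E} (hx : M.IsFeasible x) :
    DifferentiableAt ℝ M.obj x :=
  (hx.differentiableAt_div_power (M.minorant.differentiable x)).const_mul M.B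

/-- The objective and its surrogate around `x` have the same derivative at `x`. -/
theorem IsFeasible.hasFDerivAt_sur {x : E} (hx : M.IsFeasible x) :
    HasFDerivAt (fun v => M.B * M.sur x v) (fderiv ℝ M.obj x) x := by
  have hs : DifferentiableAt ℝ (fun v => M.B * M.sur x v) x :=
    (hx.differentiableAt_div_power (M.minorant.differentiableAt x)).const_mul M.B
  -- The gap is nonnegative wherever the power is positive, in particular near `x`, and zero at `x`;
  -- its derivative there must vanish.
  have hmin : IsLocalMin (fun v => M.obj v - M.B * M.sur x v) x := by
    have hpos : ∀ᶠ v in 𝓝 x, 0 < M.quad v + M.C :=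
      (M.continuous_quad.add continuous_const).continuousAt.eventually_const_lt hx.power_pos
    filter_upwards [hpos] with v hv
    rw [M.obj_self, sub_self]
    exact sub_nonneg.2 (M.mul_sur_le_obj x hv)
  have h0 := hmin.hasFDerivAt_eq_zero (hx.differentiableAt_obj.hasFDerivAt.sub hs.hasFDerivAt)
  rw [sub_eq_zero.1 h0]
  exact hs.hasFDerivAt

/-! ### First-order optimality -/

/-- Points that satisfy the constraints of the surrogate problem strictly. -/
def IsStrictSurFeasible (M : SurrogateModel E) (x v : E) : Prop :=
  M.quad v < M.P + M.τ ∧ M.τ < M.quad x + 2 * M.form x (v - x)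

/-- Along `d` the one-sided difference quotients of the surrogate are nonpositive, and their limit
is the derivative of the objective because the two agree to first order at `x`. -/
theorem IsFeasible.fderiv_nonpos {x : E} (hx : M.IsFeasible x)
    (hmax : ∀ v, M.IsStrictSurFeasible x v → M.sur x v ≤ M.sur x x) {d : E}
    (hd : ∀ᶠ t : ℝ in 𝓝[>] 0, M.IsStrictSurFeasible x (x + t • d)) :
    fderiv ℝ M.obj x d ≤ 0 := by
  have h1 : HasDerivAt (fun t : ℝ => M.B * M.sur x (x + t • d)) (fderiv ℝ M.obj x d) 0 := by
    have hl : HasDerivAt (fun t : ℝ => x + t • d) d 0 := by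
      simpa using ((hasDerivAt_id (0 : ℝ)).smul_const d).const_add x
    have h : HasFDerivAt (fun v => M.B * M.sur x v) (fderiv ℝ M.obj x) (x + (0 : ℝ) • d) := by
      simpa using hx.hasFDerivAt_sur
    exact h.comp_hasDerivAt (0 : ℝ) hl
  refine le_of_tendsto h1.tendsto_slope_zero_right ?_
  filter_upwards [hd, self_mem_nhdsWithin] with t ht ht0
  have h2 := mul_le_mul_of_nonneg_left (hmax _ ht) M.B_pos.le
  simp only [zero_add, zero_smul, add_zero, smul_eq_mul]
  exact mul_nonpos_of_nonneg_of_nonpos (inv_nonneg.2 (le_of_lt ht0)) (by linarith)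

/-- Farkas' lemma for a single inequality. Adding large multiples of a kernel vector to `x` stays in
the half-space, so `D ≤ 0` on the kernel of `L`; by symmetry `D` vanishes there and is a multiple of
`L`. -/
theorem eq_smul_of_nonpos_halfspace {D L : E →L[ℝ] ℝ} {x : E} (hx : 0 < L x)
    (h : ∀ d, 0 < L d → D d ≤ 0) : D = (D x / L x) • L ∧ D x ≤ 0 := by
  have hker : ∀ d, L d = 0 → D d ≤ 0 := fun d hd => by
    by_contra! hpos
    -- The coefficient is chosen so that `D` takes the value `1` at this vector.
    have h1 := h ((((1 - D x) / D d) : ℝ) • d + x) (by simpa [hd] using hx)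
    simp only [map_add, map_smul, smul_eq_mul] at h1
    rw [div_mul_cancel₀ _ hpos.ne'] at h1
    linarith
  refine ⟨?_, h x hx⟩
  ext d
  have h1 := hker (d - (L d / L x) • x) (by simp [hx.ne'])
  have h2 := hker (-(d - (L d / L x) • x)) (by simp [hx.ne'])
  simp only [map_sub, map_smul, map_neg, smul_eq_mul] at h1 h2
  have : D d = L d / L x * D x := by linarith
  rw [this]
  simp only [_root_.smul_apply, smul_eq_mul]
  ring

/-- The two constraints have opposite gradients, so only the difference of the multipliers enters
stationarity. -/
theorem IsFeasible.isKKT_of_multipliers {x : E} (hx : M.IsFeasible x) {a b : ℝ} (ha : 0 ≤ a)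
    (hb : 0 ≤ b) (ha' : a * (M.τ - M.quad x) = 0) (hb' : b * (M.quad x - (M.P + M.τ)) = 0)
    (h : fderiv ℝ M.obj x = (b - a) • fderiv ℝ M.quad x) : M.IsKKT x := by
  have hq := (M.hasFDerivAt_quad x)
  refine ⟨hx.differentiableAt_obj, ?_, ?_, ![a, b], ?_, ?_, ?_⟩
  · refine Fin.forall_fin_two.2 ⟨?_, ?_⟩
    · exact hq.differentiableAt.const_sub _
    · exact hq.differentiableAt.sub_const _
  · exact Fin.forall_fin_two.2 ⟨sub_nonpos.2 hx.1, sub_nonpos.2 hx.2⟩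
  · exact Fin.forall_fin_two.2 ⟨ha, hb⟩
  · exact Fin.forall_fin_two.2 ⟨ha', hb'⟩
  · have e0 : fderiv ℝ (M.constr 0) x = -fderiv ℝ M.quad x := fderiv_const_sub _
    have e1 : fderiv ℝ (M.constr 1) x = fderiv ℝ M.quad x := fderiv_sub_const _
    rw [Fin.sum_univ_two, e0, e1, h]
    simp only [cons_val_zero, cons_val_one]
    module

/-- Slater's condition holds for the surrogate problem around a feasible point, so a feasible point
that no strictly feasible point of its surrogate problem improves is a KKT point. -/
theorem IsFeasible.isKKT {x : E} (hx : M.IsFeasible x)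
    (hmax : ∀ v, M.IsStrictSurFeasible x v → M.sur x v ≤ M.sur x x) : M.IsKKT x := by
  rcases M.pos_or_subsingleton with hτ | hE
  swap
  · refine hx.isKKT_of_multipliers le_rfl le_rfl (zero_mul _) (zero_mul _) ?_
    ext d
    simp [Subsingleton.elim d 0]
  have hq := M.hasFDerivAt_quad x
  -- The radial direction `x` strictly increases the power; it and `-x` serve as interior directions
  -- for the lower and the upper constraint.
  have hL : 0 < fderiv ℝ M.quad x x := by
    rw [hq.fderiv]
    simpa [← M.quad_eq] using hτ.trans_le hx.1
  have hcont : ∀ d, Continuous fun t : ℝ => M.quad (x + t • d) := fun d =>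
    M.continuous_quad.comp (by fun_prop)
  have hcont' : ∀ d, Continuous fun t : ℝ => M.quad x + 2 * M.form x (x + t • d - x) := fun d => by
    fun_prop
  have hlt1 : ∀ d, M.quad x < M.P + M.τ → ∀ᶠ t : ℝ in 𝓝[>] 0, M.quad (x + t • d) < M.P + M.τ :=
    fun d h => ((hcont d).tendsto' 0 (M.quad x) (by simp)).mono_left nhdsWithin_le_nhds
      |>.eventually_lt_const h
  have hlt2 : ∀ d, M.τ < M.quad x →
      ∀ᶠ t : ℝ in 𝓝[>] 0, M.τ < M.quad x + 2 * M.form x (x + t • d - x) :=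
    fun d h => ((hcont' d).tendsto' 0 (M.quad x) (by simp)).mono_left nhdsWithin_le_nhds
      |>.eventually_const_lt h
  rcases hx.1.eq_or_lt with h0 | h0
  -- Lower constraint active. As `P > 0`, the upper one is slack, and every direction of increasing
  -- power is strictly feasible.
  · have h1 : M.quad x < M.P + M.τ := by linarith [M.P_pos]
    obtain ⟨e, hn⟩ := eq_smul_of_nonpos_halfspace hL (D := fderiv ℝ M.obj x) fun d hd => by
      refine hx.fderiv_nonpos hmax ?_
      filter_upwards [hlt1 d h1, self_mem_nhdsWithin] with t ht ht0
      refine ⟨ht, ?_⟩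
      rw [hq.fderiv] at hd
      have hd' : 0 < M.form x d := by simpa using hd
      have := mul_pos (show (0 : ℝ) < t from ht0) hd'
      simp only [add_sub_cancel_left, map_smul, smul_eq_mul]
      linarith
    refine hx.isKKT_of_multipliers (a := -(fderiv ℝ M.obj x x / fderiv ℝ M.quad x x)) (b := 0)
      (neg_nonneg.2 (div_nonpos_of_nonpos_of_nonneg hn hL.le)) le_rfl (by simp [h0]) (by simp) ?_
    rwa [zero_sub, neg_neg]
  rcases hx.2.eq_or_lt with h1 | h1
  -- Upper constraint active: the directions of decreasing power are strictly feasible, the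
  -- second-order term being negligible for small `t`.
  · obtain ⟨e, hn⟩ := eq_smul_of_nonpos_halfspace (x := -x) (D := fderiv ℝ M.obj x)
      (L := -fderiv ℝ M.quad x) (by simpa using hL) fun d hd => by
      refine hx.fderiv_nonpos hmax ?_
      rw [hq.fderiv] at hd
      have hd' : 2 * M.form x d < 0 := by simpa using hd
      have hsmall : ∀ᶠ t : ℝ in 𝓝[>] 0, 2 * M.form x d + t * M.form d d < 0 := by
        have hc : Continuous fun t : ℝ => 2 * M.form x d + t * M.form d d := by fun_prop
        exact (hc.tendsto' 0 (2 * M.form x d) (by simp)).mono_left nhdsWithin_le_nhds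
          |>.eventually_lt_const hd'
      filter_upwards [hlt2 d h0, hsmall, self_mem_nhdsWithin] with t ht hs ht0
      refine ⟨?_, ht⟩
      have := mul_neg_of_pos_of_neg (show (0 : ℝ) < t from ht0) hs
      rw [M.quad_eq, M.psd.apply_add_smul, ← M.quad_eq, h1]
      nlinarith
    refine hx.isKKT_of_multipliers (a := 0) (b := fderiv ℝ M.obj x x / fderiv ℝ M.quad x x)
      le_rfl (div_nonneg ?_ hL.le) (by simp) (by simp [h1]) ?_
    · simpa using hn
    · rw [sub_zero]
      conv_lhs => rw [e]
      simp [neg_div]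
  -- No constraint active: all directions, hence also `-d`, are admissible and the derivative
  -- vanishes.
  · have h : ∀ d, fderiv ℝ M.obj x d ≤ 0 := fun d => hx.fderiv_nonpos hmax <| by
      filter_upwards [hlt1 d h1, hlt2 d h0] with t ht ht' using ⟨ht, ht'⟩
    refine hx.isKKT_of_multipliers le_rfl le_rfl (zero_mul _) (zero_mul _) ?_
    ext d
    have := h (-d)
    rw [map_neg] at this
    simpa using le_antisymm (h d) (by linarith)

/-! ### Compactness, existence of surrogate solutions and the gain of one step -/

variable (M)

theorem isCompact_quad_le [ProperSpace E] (r : ℝ) : IsCompact {v : E | M.quad v ≤ r} := by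
  refine Metric.isCompact_of_isClosed_isBounded
    (isClosed_le M.continuous_quad continuous_const) ?_
  refine (Metric.isBounded_closedBall (x := (0 : E)) (r := √(r / M.m))).subset fun v hv => ?_
  rw [mem_closedBall_zero_iff]
  refine Real.le_sqrt_of_sq_le ?_
  rw [le_div_iff₀ M.m_pos]
  linarith [M.coercive v, Set.mem_ofPred.1 hv]

theorem isCompact_isFeasible [ProperSpace E] : IsCompact {v : E | M.IsFeasible v} := by
  have : {v : E | M.IsFeasible v} = {v | M.quad v ≤ M.P + M.τ} ∩ {v | M.τ ≤ M.quad v} := by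
    ext v
    exact and_comm
  rw [this]
  exact (M.isCompact_quad_le _).inter_right (isClosed_le continuous_const M.continuous_quad)

theorem continuousOn_sur : ContinuousOn (Function.uncurry M.sur)
    {z : E × E | 0 < M.quad z.2 + M.C} := by
  refine (M.minorant.continuous.continuousOn).div ?_ fun z hz => ne_of_gt hz
  exact ((M.continuous_quad.comp continuous_snd).add continuous_const).continuousOn

variable {M}

theorem IsFeasible.exists_isSurSolution [ProperSpace E] {x : E} (hx : M.IsFeasible x) :
    ∃ v, M.IsSurSolution x v := by
  have hcomp : IsCompact {v : E | M.IsSurFeasible x v} :=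
    (M.isCompact_quad_le (M.P + M.τ)).inter_right (isClosed_le continuous_const
      (by fun_prop : Continuous fun v => M.quad x + 2 * M.form x (v - x)))
  have hcont : ContinuousOn (M.sur x) {v : E | M.IsSurFeasible x v} :=
    M.continuousOn_sur.comp (f := fun v => (x, v)) (by fun_prop)
      fun v (hv : M.IsSurFeasible x v) => hv.isFeasible.power_pos
  obtain ⟨v, hv, hmax⟩ := hcomp.exists_isMaxOn ⟨x, hx.isSurFeasible_self⟩ hcont
  exact ⟨v, hv, fun w hw => hmax hw⟩

/-- The basic comparison: optimality of `v` for the surrogate, then minorization at `v`. It is used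
with `w = x` for monotonicity and with a fixed competitor at limit points. -/
theorem IsSurSolution.mul_sur_le_obj {x v w : E} (h : M.IsSurSolution x v)
    (hw : M.IsSurFeasible x w) : M.B * M.sur x w ≤ M.obj v :=
  (mul_le_mul_of_nonneg_left (h.2 w hw) M.B_pos.le).trans
    (M.mul_sur_le_obj x h.isFeasible.power_pos)

theorem IsSurSolution.obj_le {x v : E} (h : M.IsSurSolution x v) (hx : M.IsFeasible x) :
    M.obj x ≤ M.obj v := by
  simpa only [M.obj_self] using h.mul_sur_le_obj hx.isSurFeasible_self

theorem IsStrictSurFeasible.isSurFeasible {x v : E} (h : M.IsStrictSurFeasible x v) :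
    M.IsSurFeasible x v :=
  ⟨h.1.le, h.2.le⟩

/-- Without a gain, `x` is at least as good as every competitor in its own surrogate problem, hence
a KKT point. -/
theorem IsSurSolution.obj_lt {x v : E} (h : M.IsSurSolution x v) (hx : M.IsFeasible x)
    (hK : ¬ M.IsKKT x) : M.obj x < M.obj v := by
  by_contra! hle
  refine hK (hx.isKKT fun w hw => ?_)
  have := (h.mul_sur_le_obj hw.isSurFeasible).trans hle
  rw [← M.obj_self] at this
  exact le_of_mul_le_mul_left this M.B_pos

/-- Strong concavity: a solution of the surrogate problem with positive value improves the
objective by a multiple of the squared step length. -/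
theorem IsSurSolution.obj_add_le {x v : E} (h : M.IsSurSolution x v) (hx : M.IsFeasible x)
    (hpos : 0 < M.obj x) :
    M.obj x + M.obj x * M.m / (2 * (M.P + M.τ + M.C)) * ‖v - x‖ ^ 2 ≤ M.obj v := by
  have hB := M.B_pos
  have hPx := hx.power_pos
  have hPv := h.isFeasible.power_pos
  have hPtot : 0 < M.P + M.τ + M.C := by linarith [M.P_pos, M.power_pos]
  -- Dinkelbach's device: for the optimal ratio `s`, the function `minor x - s * (quad + C)` is
  -- nonpositive on the surrogate-feasible set and zero at `v`. Since `s > 0`, it is strongly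
  -- concave.
  set s := M.sur x v with hs
  have hxs : M.obj x ≤ M.B * s := by
    rw [← M.obj_self]
    exact mul_le_mul_of_nonneg_left (h.2 x hx.isSurFeasible_self) hB.le
  have hs0 : 0 < s := pos_of_mul_pos_right (hpos.trans_le hxs) hB.le
  -- Test optimality at the midpoint, which is surrogate-feasible because that feasible set is
  -- convex.
  set w : E := (2⁻¹ : ℝ) • (x + v) with hw
  have hquad : M.quad w = 2⁻¹ * (M.quad x + M.quad v) - 4⁻¹ * M.quad (v - x) := by
    simp only [M.quad_eq]
    exact M.psd.apply_midpoint x v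
  have hstep := M.coercive (v - x)
  have hnn : 0 ≤ M.m * ‖v - x‖ ^ 2 := mul_nonneg M.m_pos.le (sq_nonneg _)
  have hwf : M.IsSurFeasible x w := by
    refine ⟨by linarith [hx.2, h.1.1], ?_⟩
    have : w - x = (2⁻¹ : ℝ) • (v - x) := by rw [hw]; module
    rw [this, map_smul, smul_eq_mul]
    linarith [hx.1, h.1.2]
  have h1 : M.minor x w ≤ s * (M.quad w + M.C) := by
    have := h.2 w hwf
    rwa [sur, div_le_iff₀ hwf.isFeasible.power_pos] at this
  have h2 : M.minor x v = s * (M.quad v + M.C) := by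
    rw [hs, sur, div_mul_cancel₀ _ hPv.ne']
  have h3 := M.minorant.midpoint x x v
  rw [← hw, h2, M.minorant.self] at h3
  -- The midpoint defect, doubled, becomes half of `quad (v - x)`, which coercivity bounds below.
  have h4 : M.rate x ≤ s * (M.quad x + M.C) - s * (2⁻¹ * (M.m * ‖v - x‖ ^ 2)) := by
    have := mul_le_mul_of_nonneg_left hstep hs0.le
    rw [hquad] at h1
    linarith
  have h5 : M.obj x * (M.quad x + M.C) = M.B * M.rate x := by
    rw [obj]
    field_simp
  have h6 : M.obj x * (M.quad x + M.C) + M.obj x * (2⁻¹ * (M.m * ‖v - x‖ ^ 2)) ≤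
      M.B * s * (M.quad x + M.C) := by
    have a := mul_le_mul_of_nonneg_left h4 hB.le
    have c := mul_le_mul_of_nonneg_right hxs (by positivity : 0 ≤ 2⁻¹ * (M.m * ‖v - x‖ ^ 2))
    rw [h5]
    linarith
  have h7 : M.obj x + M.obj x * (2⁻¹ * (M.m * ‖v - x‖ ^ 2)) / (M.quad x + M.C) ≤ M.B * s := by
    rw [← sub_nonneg] at h6 ⊢
    have := div_nonneg h6 hPx.le
    refine this.trans (le_of_eq ?_)
    field_simp
  have h8 : M.obj x * (2⁻¹ * (M.m * ‖v - x‖ ^ 2)) / (M.P + M.τ + M.C) ≤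
      M.obj x * (2⁻¹ * (M.m * ‖v - x‖ ^ 2)) / (M.quad x + M.C) := by
    have := hx.2
    gcongr
  have h9 : M.obj x * M.m / (2 * (M.P + M.τ + M.C)) * ‖v - x‖ ^ 2 =
      M.obj x * (2⁻¹ * (M.m * ‖v - x‖ ^ 2)) / (M.P + M.τ + M.C) := by
    field_simp
  rw [h9]
  linarith [M.mul_sur_le_obj x hPv]

/-! ### Convergence of the iterates -/

namespace IsRun

variable {γ : ℕ → E} (hγ : M.IsRun γ)
include hγ

theorem isFeasible : ∀ n, M.IsFeasible (γ n)
  | 0 => hγ.1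
  | n + 1 => (hγ.2 n).isFeasible

theorem monotone_obj : Monotone fun n => M.obj (γ n) :=
  monotone_nat_of_le_succ fun n => (hγ.2 n).obj_le (hγ.isFeasible n)

theorem obj_lt (n : ℕ) (h : ¬ M.IsKKT (γ n)) : M.obj (γ n) < M.obj (γ (n + 1)) :=
  (hγ.2 n).obj_lt (hγ.isFeasible n) h

theorem exists_tendsto_obj [ProperSpace E] :
    ∃ L, Tendsto (fun n => M.obj (γ n)) atTop (𝓝 L) := by
  have hc : ContinuousOn M.obj {v | M.IsFeasible v} := fun v hv =>
    (IsFeasible.differentiableAt_obj hv).continuousAt.continuousWithinAt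
  obtain ⟨C, hC⟩ := M.isCompact_isFeasible.bddAbove_image hc
  exact ⟨_, tendsto_atTop_ciSup hγ.monotone_obj
    ⟨C, by rintro _ ⟨n, rfl⟩; exact hC ⟨γ n, hγ.isFeasible n, rfl⟩⟩⟩

theorem isFeasible_of_mapClusterPt [ProperSpace E] {x : E} (hx : MapClusterPt x atTop γ) :
    M.IsFeasible x :=
  M.isCompact_isFeasible.isClosed.mem_of_mapClusterPt hx (.of_forall hγ.isFeasible)

theorem obj_eq_of_mapClusterPt [ProperSpace E] {L : ℝ}
    (hL : Tendsto (fun n => M.obj (γ n)) atTop (𝓝 L)) {x : E} (hx : MapClusterPt x atTop γ) :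
    M.obj x = L := by
  have h := hx.continuousAt_comp (hγ.isFeasible_of_mapClusterPt hx).differentiableAt_obj.continuousAt
  exact eq_of_nhds_neBot (h.clusterPt.mono hL)

/-- A strictly feasible competitor `v` that beats `x` in the surrogate at `x` stays feasible, and
still beats the value `L`, in the surrogate at iterates near `x`. The successor of such an iterate
would exceed `L`, the limit of a monotone sequence. Convergence of the successors is not needed. -/
theorem isKKT_of_mapClusterPt [ProperSpace E] {x : E} (hx : MapClusterPt x atTop γ) :
    M.IsKKT x := by
  obtain ⟨L, hL⟩ := hγ.exists_tendsto_obj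
  have hxL := hγ.obj_eq_of_mapClusterPt hL hx
  refine (hγ.isFeasible_of_mapClusterPt hx).isKKT fun v hv => ?_
  by_contra! hlt
  have hcont : ContinuousAt (fun y => M.sur y v) x :=
    ((M.continuousOn_sur.continuousAt ((isOpen_lt continuous_const
      ((M.continuous_quad.comp continuous_snd).add continuous_const)).mem_nhds
        hv.isSurFeasible.isFeasible.power_pos)).comp (f := fun y => (y, v)) (by fun_prop))
  have h1 : ∀ᶠ y in 𝓝 x, M.sur x x < M.sur y v := hcont.eventually_const_lt hlt
  have hq := M.continuous_quad
  have hc2 : Continuous fun y => M.quad y + 2 * M.form y (v - y) := by fun_prop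
  have h2 : ∀ᶠ y in 𝓝 x, M.τ < M.quad y + 2 * M.form y (v - y) :=
    hc2.continuousAt.eventually_const_lt hv.2
  obtain ⟨n, hn1, hn2⟩ := (hx.frequently (h1.and h2)).exists
  have h3 := (hγ.2 n).mul_sur_le_obj ⟨hv.1.le, hn2.le⟩
  have h4 := hγ.monotone_obj.ge_of_tendsto hL (n + 1)
  have h5 := mul_lt_mul_of_pos_left hn1 M.B_pos
  rw [M.obj_self] at h5
  linarith

theorem exists_mapClusterPt [ProperSpace E] : ∃ x, MapClusterPt x atTop γ := by
  obtain ⟨x, -, hx⟩ := M.isCompact_isFeasible.exists_mapClusterPt (f := atTop) (u := γ)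
    (tendsto_principal.2 (.of_forall hγ.isFeasible))
  exact ⟨x, hx⟩

/-- Otherwise a subsequence stays away from all KKT points, while by compactness it has a limit
point, which is one. -/
theorem eventually_exists_isKKT [ProperSpace E] {δ : ℝ} (hδ : 0 < δ) :
    ∀ᶠ n in atTop, ∃ x, M.IsKKT x ∧ ‖γ n - x‖ < δ := by
  by_contra hcon
  obtain ⟨φ, hφ, hfar⟩ := extraction_of_frequently_atTop (not_eventually.1 hcon)
  obtain ⟨x, -, ψ, hψ, hx⟩ := M.isCompact_isFeasible.tendsto_subseq fun n => hγ.isFeasible (φ n)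
  have hK : M.IsKKT x := hγ.isKKT_of_mapClusterPt <| hx.mapClusterPt.of_comp
    (φ := φ ∘ ψ) (hφ.comp hψ).tendsto_atTop
  obtain ⟨n, hn⟩ := (hx.eventually (Metric.ball_mem_nhds x hδ)).exists
  exact hfar _ ⟨x, hK, by simpa [dist_eq_norm] using hn⟩

/-- Late outputs are close to KKT points anyway. The finitely many early nonzero steps are bounded
below, so a small tolerance can stop the algorithm early only at a zero step, that is, at a fixed
point; by strict increase, fixed points are KKT points. -/
theorem exists_tolerance [ProperSpace E] {δ : ℝ} (hδ : 0 < δ) :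
    ∃ ε₀ > 0, ∀ ε ≤ ε₀, ∀ n, StopsAt γ ε n → ∃ x, M.IsKKT x ∧ ‖γ (n + 1) - x‖ < δ := by
  obtain ⟨n₀, hn₀⟩ := eventually_atTop.1 (hγ.eventually_exists_isKKT hδ)
  have hε : ∀ k : ℕ, ∃ ε₀ > 0, ∀ n < k, γ (n + 1) ≠ γ n → ε₀ ≤ ‖γ (n + 1) - γ n‖ := fun k => by
    induction k with
    | zero => exact ⟨1, one_pos, by simp⟩
    | succ k ih =>
      obtain ⟨ε₀, h0, h⟩ := ih
      by_cases hk : γ (k + 1) = γ k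
      · refine ⟨ε₀, h0, fun n hn hne => ?_⟩
        rcases Nat.lt_succ_iff_lt_or_eq.1 hn with h' | rfl
        exacts [h n h' hne, absurd hk hne]
      · refine ⟨min ε₀ ‖γ (k + 1) - γ k‖, lt_min h0 (norm_pos_iff.2 (sub_ne_zero.2 hk)),
          fun n hn hne => ?_⟩
        rcases Nat.lt_succ_iff_lt_or_eq.1 hn with h' | rfl
        exacts [(min_le_left _ _).trans (h n h' hne), min_le_right _ _]
  obtain ⟨ε₀, h0, h⟩ := hε n₀
  refine ⟨ε₀, h0, fun ε hle n hst => ?_⟩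
  rcases lt_or_ge n n₀ with hn | hn
  · have heq : γ (n + 1) = γ n := by
      by_contra hne
      linarith [h n hn hne, hst.1]
    have hK : M.IsKKT (γ n) := by
      by_contra hK
      have := hγ.obj_lt n hK
      rw [heq] at this
      exact lt_irrefl _ this
    exact ⟨γ n, hK, by simpa [heq] using hδ⟩
  · exact hn₀ (n + 1) (by omega)

theorem tendsto_norm_step [ProperSpace E] (hpos : ∃ n, 0 < M.obj (γ n)) :
    Tendsto (fun n => ‖γ (n + 1) - γ n‖) atTop (𝓝 0) := by
  obtain ⟨n₀, hn₀⟩ := hpos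
  obtain ⟨L, hL⟩ := hγ.exists_tendsto_obj
  have hPtot : 0 < M.P + M.τ + M.C := by linarith [M.P_pos, M.power_pos]
  -- By monotonicity the gain constant at `n₀` works for all later steps.
  set c := M.obj (γ n₀) * M.m / (2 * (M.P + M.τ + M.C)) with hc
  have hc0 : 0 < c := div_pos (mul_pos hn₀ M.m_pos) (by positivity)
  have hdiff : Tendsto (fun n => (M.obj (γ (n + 1)) - M.obj (γ n)) / c) atTop (𝓝 0) := by
    simpa using ((hL.comp (tendsto_add_atTop_nat 1)).sub hL).div_const c
  have hsq : Tendsto (fun n => ‖γ (n + 1) - γ n‖ ^ 2) atTop (𝓝 0) := by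
    refine tendsto_of_tendsto_of_tendsto_of_le_of_le' tendsto_const_nhds hdiff
      (.of_forall fun n => sq_nonneg _) ?_
    filter_upwards [eventually_ge_atTop n₀] with n hn
    have hle : M.obj (γ n₀) ≤ M.obj (γ n) := hγ.monotone_obj hn
    have h := (hγ.2 n).obj_add_le (hγ.isFeasible n) (hn₀.trans_le hle)
    have hcn : c ≤ M.obj (γ n) * M.m / (2 * (M.P + M.τ + M.C)) := by
      have := M.m_pos
      rw [hc]
      gcongr
    rw [le_div_iff₀ hc0]
    nlinarith [mul_le_mul_of_nonneg_right hcn (sq_nonneg ‖γ (n + 1) - γ n‖)]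
  simpa [Function.comp_def] using (Real.continuous_sqrt.tendsto' 0 0 Real.sqrt_zero).comp hsq

end IsRun

end SurrogateModel

theorem exists_stopsAt {E : Type*} [NormedAddCommGroup E] {γ : ℕ → E}
    (h : Tendsto (fun n => ‖γ (n + 1) - γ n‖) atTop (𝓝 0)) {ε : ℝ} (hε : 0 < ε) :
    ∃ n, StopsAt γ ε n := by
  classical
  have hex : ∃ n, ‖γ (n + 1) - γ n‖ < ε := (h.eventually_lt_const hε).exists
  exact ⟨Nat.find hex, Nat.find_spec hex, fun m hm => not_lt.1 (Nat.find_min hex hm)⟩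


/-! ### Concave minorants of logarithmic rates -/

section Minorants

variable {E : Type*} [NormedAddCommGroup E] [NormedSpace ℝ E]

theorem IsPSDQuadratic.nonneg {q : E → ℝ} (h : IsPSDQuadratic q) (v : E) : 0 ≤ q v := by
  obtain ⟨b, hb, e⟩ := h
  rw [e]
  exact hb.nonneg v

theorem IsPSDQuadratic.differentiable {q : E → ℝ} (h : IsPSDQuadratic q) :
    Differentiable ℝ q := by
  obtain ⟨b, hb, e⟩ := h
  rw [funext e]
  exact fun x => (hb.hasFDerivAt x).differentiableAt

theorem IsPSDQuadratic.midpoint_le {q : E → ℝ} (h : IsPSDQuadratic q) (u v : E) :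
    q ((2⁻¹ : ℝ) • (u + v)) ≤ 2⁻¹ * (q u + q v) := by
  obtain ⟨b, hb, e⟩ := h
  simp only [e, hb.apply_midpoint]
  linarith [hb.nonneg (v - u)]

namespace IsConcaveMinorant

theorem zero : IsConcaveMinorant (fun _ : E => (0 : ℝ)) fun _ _ => 0 where
  continuous := continuous_const
  le _ _ := le_rfl
  self _ := rfl
  differentiable := differentiable_const _
  differentiableAt _ := differentiableAt_const _
  midpoint _ _ _ := by simp

theorem add {r₁ r₂ : E → ℝ} {s₁ s₂ : E → E → ℝ} (h₁ : IsConcaveMinorant r₁ s₁)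
    (h₂ : IsConcaveMinorant r₂ s₂) :
    IsConcaveMinorant (fun v => r₁ v + r₂ v) fun x v => s₁ x v + s₂ x v where
  continuous := h₁.continuous.add h₂.continuous
  le x v := add_le_add (h₁.le x v) (h₂.le x v)
  self x := by rw [h₁.self, h₂.self]
  differentiable := h₁.differentiable.fun_add h₂.differentiable
  differentiableAt x := (h₁.differentiableAt x).fun_add (h₂.differentiableAt x)
  midpoint x u v := by linarith [h₁.midpoint x u v, h₂.midpoint x u v]

theorem sum {ι : Type*} (t : Finset ι) {r : ι → E → ℝ} {s : ι → E → E → ℝ}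
    (h : ∀ i, IsConcaveMinorant (r i) (s i)) :
    IsConcaveMinorant (fun v => ∑ i ∈ t, r i v) fun x v => ∑ i ∈ t, s i x v := by
  classical
  induction t using Finset.induction_on with
  | empty => simpa using zero
  | insert i t hi ih => simpa only [Finset.sum_insert hi] using (h i).add ih

end IsConcaveMinorant

/-- Lower bound around `v₀` of `log₂ (1 + x / y)`, with `√x` replaced by its first-order Taylor
expansion. -/
def logRatioMinorant (x y : E → ℝ) (v₀ v : E) : ℝ :=
  Real.logb 2 (1 + x v₀ / y v₀) +
    1 / Real.log 2 * (x v₀ / y v₀ *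
      (2 * firstOrderTaylor (fun v => √(x v)) v₀ v / √(x v₀)
        - (x v + y v) / (x v₀ + y v₀) - 1))

/-- Covers a zero receive filter, where `y` vanishes as well and no positivity is available. -/
theorem isConcaveMinorant_logRatioMinorant_of_eq_zero {x : E → ℝ} (hx : ∀ v, x v = 0)
    (y : E → ℝ) :
    IsConcaveMinorant (fun v => Real.logb 2 (1 + x v / y v)) (logRatioMinorant x y) := by
  have e1 : (fun v => Real.logb 2 (1 + x v / y v)) = fun _ => 0 := by
    ext v
    simp [hx]
  have e2 : logRatioMinorant x y = fun _ _ => 0 := by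
    ext v₀ v
    simp [logRatioMinorant, hx]
  rw [e1, e2]
  exact .zero

/-- A form without square roots or division by `x v₀`. It remains correct at zeros of `x`, where
Cauchy-Schwarz kills `b v₀ v`, and it makes joint continuity and concavity visible. -/
theorem logRatioMinorant_eq {b : E →L[ℝ] E →L[ℝ] ℝ} (hb : IsPSDForm b) {x : E → ℝ}
    (hx : ∀ v, x v = b v v) (y : E → ℝ) (v₀ v : E) :
    logRatioMinorant x y v₀ v = Real.logb 2 (1 + x v₀ / y v₀) +
      1 / Real.log 2 *
        (2 * b v₀ v / y v₀ - x v₀ / y v₀ * ((x v + y v) / (x v₀ + y v₀)) - x v₀ / y v₀) := by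
  rw [logRatioMinorant]
  congr 2
  rcases (hb.nonneg v₀).eq_or_lt with h | h
  · rw [hx v₀, ← h, hb.apply_eq_zero h.symm]
    simp
  · have hs := Real.sqrt_pos.2 h
    rw [funext hx, hb.firstOrderTaylor_sqrt h]
    have e : 2 * (b v₀ v / √(b v₀ v₀)) / √(b v₀ v₀) = 2 * b v₀ v / b v₀ v₀ := by
      nth_rw 3 [← Real.mul_self_sqrt h.le]
      field_simp
    simp only [e]
    field_simp

theorem isConcaveMinorant_logRatioMinorant {x y : E → ℝ} (hx : IsPSDQuadratic x) {c : ℝ}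
    (hc : 0 < c) (hy : IsPSDQuadratic fun v => y v - c) :
    IsConcaveMinorant (fun v => Real.logb 2 (1 + x v / y v)) (logRatioMinorant x y) := by
  have hx0 := hx.nonneg
  have hxd := hx.differentiable
  have hy0 : ∀ v, 0 < y v := fun v => by linarith [hy.nonneg v]
  have hyd : Differentiable ℝ y := by simpa using hy.differentiable.add_const c
  have hxc := hxd.continuous
  have hyc := hyd.continuous
  have hmx := hx.midpoint_le
  have hmy := hy.midpoint_le
  have hlog : 0 < Real.log 2 := Real.log_pos one_lt_two
  obtain ⟨b, hb, e⟩ := hx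
  have hs : logRatioMinorant x y = _ :=
    funext fun v₀ => funext fun v => logRatioMinorant_eq hb e y v₀ v
  rw [hs]
  have hq0 : ∀ v, 0 ≤ x v / y v := fun v => div_nonneg (hx0 v) (hy0 v).le
  have hxy : ∀ v, x v + y v ≠ 0 := fun v => (add_pos_of_nonneg_of_pos (hx0 v) (hy0 v)).ne'
  have hq1 : ∀ v, 1 + x v / y v ≠ 0 := fun v => (add_pos_of_pos_of_nonneg one_pos (hq0 v)).ne'
  constructor
  · have h1 : ∀ z : E × E, y z.1 ≠ 0 := fun z => (hy0 _).ne'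
    have h2 : ∀ z : E × E, x z.1 + y z.1 ≠ 0 := fun z => hxy z.1
    have h3 : Continuous fun z : E × E => Real.log (1 + x z.1 / y z.1) :=
      (continuous_const.add ((hxc.comp continuous_fst).div (hyc.comp continuous_fst) h1)).log
        fun z => hq1 z.1
    unfold Function.uncurry Real.logb
    fun_prop (disch := assumption)
  · intro v₀ v
    have h := log_one_add_div_ge (hx0 v) (hy0 v) (hx0 v₀) (hy0 v₀)
    -- Linearizing the seminorm only lowers the bound, by Cauchy-Schwarz.
    have hbs : 2 * b v₀ v / y v₀ ≤ 2 * (√(x v₀) * √(x v)) / y v₀ := by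
      have := hb.apply_le_sqrt_mul_sqrt v₀ v
      have := (hy0 v₀).le
      rw [e, e]
      gcongr
    rw [Real.logb, Real.logb, div_mul_eq_mul_div, one_mul, ← add_div]
    gcongr
    linarith
  · intro v₀
    have h1 := (hy0 v₀).ne'
    have h2 := hxy v₀
    simp only [← e]
    field_simp
    ring
  · intro v
    have h1 := (hy0 v).ne'
    have h2 : DifferentiableAt ℝ (fun v => x v / y v) v := by
      simpa only [div_eq_mul_inv] using (hxd v).fun_mul ((hyd v).fun_inv h1)
    have h3 : DifferentiableAt ℝ (fun v => Real.log (1 + x v / y v)) v :=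
      (h2.const_add 1).log (hq1 v)
    simpa only [Real.logb, div_eq_mul_inv] using h3.mul_const (Real.log 2)⁻¹
  · intro v₀
    simp only [div_eq_mul_inv]
    fun_prop
  · intro v₀ u v
    have h1 : x v₀ / y v₀ * ((x ((2⁻¹ : ℝ) • (u + v)) + y ((2⁻¹ : ℝ) • (u + v))) / (x v₀ + y v₀)) ≤
        2⁻¹ * (x v₀ / y v₀ * ((x u + y u) / (x v₀ + y v₀)) +
          x v₀ / y v₀ * ((x v + y v) / (x v₀ + y v₀))) := by
      have : 0 < x v₀ + y v₀ := by linarith [hx0 v₀, hy0 v₀]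
      rw [← mul_add, ← add_div, mul_left_comm, ← mul_div_assoc 2⁻¹]
      refine mul_le_mul_of_nonneg_left ?_ (hq0 v₀)
      gcongr
      linarith [hmx u v, hmy u v]
    have h2 : 2 * b v₀ ((2⁻¹ : ℝ) • (u + v)) / y v₀ =
        2⁻¹ * (2 * b v₀ u / y v₀ + 2 * b v₀ v / y v₀) := by
      simp only [map_smul, map_add, smul_eq_mul]
      ring
    have h3 := mul_le_mul_of_nonneg_left h1 (by positivity : 0 ≤ 1 / Real.log 2)
    simp only [h2]
    linarith

/-- The concave logarithm lies below its tangent, so its negative lies above; an affine decreasing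
function of the convex `x + y` is concave. -/
theorem isConcaveMinorant_logb_div {x y : E → ℝ} (hx : IsPSDQuadratic x) (hy : IsPSDQuadratic y)
    {c : ℝ} (hc : 0 < c) :
    IsConcaveMinorant (fun v => Real.logb 2 (c / (c + x v + y v))) fun v₀ v =>
      Real.logb 2 (c / (c + x v₀ + y v₀)) -
        1 / Real.log 2 * ((x v + y v - x v₀ - y v₀) / (c + x v₀ + y v₀)) := by
  have hpos : ∀ v, 0 < c + x v + y v := fun v => by linarith [hx.nonneg v, hy.nonneg v]
  have hlog : 0 < Real.log 2 := Real.log_pos one_lt_two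
  have hxd := hx.differentiable
  have hyd := hy.differentiable
  have hxc := hxd.continuous
  have hyc := hyd.continuous
  have heq : ∀ v, Real.logb 2 (c / (c + x v + y v)) =
      (Real.log c - Real.log (c + x v + y v)) / Real.log 2 := fun v => by
    rw [Real.logb, Real.log_div hc.ne' (hpos v).ne']
  simp only [heq]
  constructor
  · have h1 : ∀ z : E × E, c + x z.1 + y z.1 ≠ 0 := fun z => (hpos _).ne'
    unfold Function.uncurry
    fun_prop (disch := assumption)
  · intro v₀ v
    have h1 := Real.log_le_sub_one_of_pos (div_pos (hpos v) (hpos v₀))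
    rw [Real.log_div (hpos v).ne' (hpos v₀).ne'] at h1
    have h2 : (c + x v + y v) / (c + x v₀ + y v₀) - 1 =
        (x v + y v - x v₀ - y v₀) / (c + x v₀ + y v₀) := by
      have := (hpos v₀).ne'
      field_simp
      ring
    rw [h2] at h1
    rw [div_mul_eq_mul_div, one_mul, ← sub_div]
    exact div_le_div_of_nonneg_right (by linarith) hlog.le
  · intro v₀
    simp
  · intro v
    simp only [div_eq_mul_inv]
    have := (hpos v).ne'
    fun_prop (disch := assumption)
  · intro v₀
    simp only [div_eq_mul_inv]
    fun_prop
  · intro v₀ u v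
    have h1 : (x ((2⁻¹ : ℝ) • (u + v)) + y ((2⁻¹ : ℝ) • (u + v)) - x v₀ - y v₀) /
        (c + x v₀ + y v₀) ≤ 2⁻¹ * ((x u + y u - x v₀ - y v₀) / (c + x v₀ + y v₀) +
          (x v + y v - x v₀ - y v₀) / (c + x v₀ + y v₀)) := by
      rw [← add_div, ← mul_div_assoc]
      have := (hpos v₀).le
      gcongr
      linarith [hx.midpoint_le u v, hy.midpoint_le u v]
    have h3 := mul_le_mul_of_nonneg_left h1 (by positivity : 0 ≤ 1 / Real.log 2)
    linarith

end Minorants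


/-! ### Quadratic functions on complex Euclidean space -/

section Euclidean

variable {N NB : ℕ}

/-- Coordinates of a complex vector, as real-linear maps. -/
def coordL (n : Fin N) : EuclideanSpace ℂ (Fin N) →L[ℝ] ℂ :=
  (EuclideanSpace.proj n : EuclideanSpace ℂ (Fin N) →L[ℂ] ℂ).restrictScalars ℝ

@[simp]
theorem coordL_apply (n : Fin N) (v : EuclideanSpace ℂ (Fin N)) : coordL n v = v n := rfl

theorem isPSDQuadratic_norm_dotProduct_sq (a : Fin N → ℂ) :
    IsPSDQuadratic fun v : EuclideanSpace ℂ (Fin N) => ‖a ⬝ᵥ v.ofLp‖ ^ 2 := by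
  convert IsPSDQuadratic.norm_sq (∑ n, (a n • EuclideanSpace.proj n :
    EuclideanSpace ℂ (Fin N) →L[ℂ] ℂ).restrictScalars ℝ) using 3 with v
  simp [dotProduct]

/-- The weighted real inner product `∑ₙ rₙ Re (uₙ* vₙ)`. -/
def weightedForm (r : Fin N → ℝ) :
    EuclideanSpace ℂ (Fin N) →L[ℝ] EuclideanSpace ℂ (Fin N) →L[ℝ] ℝ :=
  ∑ n, r n • (innerSL ℝ).bilinearComp (coordL n) (coordL n)

theorem weightedForm_apply (r : Fin N → ℝ) (u v : EuclideanSpace ℂ (Fin N)) :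
    weightedForm r u v = ∑ n, r n * (star (u n) * v n).re := by
  simp [weightedForm, Complex.inner, mul_comm (v _).re, mul_comm (v _).im]

theorem weightedForm_self (r : Fin N → ℝ) (v : EuclideanSpace ℂ (Fin N)) :
    weightedForm r v v = ∑ n, r n * ‖v n‖ ^ 2 := by
  simp [weightedForm]

theorem isPSDForm_weightedForm {r : Fin N → ℝ} (hr : ∀ n, 0 ≤ r n) :
    IsPSDForm (weightedForm r) where
  symm u v := by
    simp only [weightedForm_apply]
    refine Finset.sum_congr rfl fun n _ => ?_
    simp only [Complex.mul_re, Complex.star_def, Complex.conj_re, Complex.conj_im]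
    ring
  nonneg v := by
    rw [weightedForm_self]
    exact Finset.sum_nonneg fun n _ => mul_nonneg (hr n) (sq_nonneg _)

theorem isPSDQuadratic_weighted {r : Fin N → ℝ} (hr : ∀ n, 0 ≤ r n) :
    IsPSDQuadratic fun v : EuclideanSpace ℂ (Fin N) => ∑ n, r n * ‖v n‖ ^ 2 :=
  ⟨weightedForm r, isPSDForm_weightedForm hr, fun v => (weightedForm_self r v).symm⟩

theorem star_dotProduct_self_re (v : Fin N → ℂ) : (star v ⬝ᵥ v).re = ∑ n, ‖v n‖ ^ 2 := by
  simp only [dotProduct, Complex.re_sum, Pi.star_apply]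
  refine Finset.sum_congr rfl fun n _ => ?_
  rw [← Complex.normSq_eq_norm_sq, Complex.normSq_apply]
  simp

theorem hermForm_add (M M' : Matrix (Fin N) (Fin N) ℂ) (v : Fin N → ℂ) :
    hermForm (M + M') v = hermForm M v + hermForm M' v := by
  simp [hermForm, add_mulVec]

theorem hermForm_smul (a : ℝ) (M : Matrix (Fin N) (Fin N) ℂ) (v : Fin N → ℂ) :
    hermForm ((a : ℂ) • M) v = a * hermForm M v := by
  simp [hermForm, smul_mulVec]

theorem hermForm_one (v : Fin N → ℂ) : hermForm 1 v = ∑ n, ‖v n‖ ^ 2 := by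
  rw [hermForm, one_mulVec, star_dotProduct_self_re]

theorem hermForm_mul_conjTranspose (M : Matrix (Fin NB) (Fin N) ℂ) (v : Fin NB → ℂ) :
    hermForm (M * Mᴴ) v = ∑ n, ‖(Mᴴ *ᵥ v) n‖ ^ 2 := by
  rw [← star_dotProduct_self_re, hermForm, ← mulVec_mulVec, star_mulVec, dotProduct_mulVec,
    conjTranspose_conjTranspose]

theorem hermForm_vecMulVec (g v : Fin N → ℂ) :
    hermForm (vecMulVec g (star g)) v = ‖star g ⬝ᵥ v‖ ^ 2 := by
  rw [hermForm, vecMulVec_mulVec, dotProduct_smul, star_dotProduct v g, ← Complex.normSq_eq_norm_sq,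
    Complex.normSq_apply]
  simp

end Euclidean

/-! ### The RIS subproblem as an instance of the model -/

namespace RISNetwork

variable {K N NB : ℕ} (S : RISNetwork K N NB)

/-- The diagonal entries of `R`. -/
def weight (n : Fin N) : ℝ := (∑ k, S.p k * ‖S.h k n‖ ^ 2) + S.varRIS

/-- All `H_k` are diagonal, so the trace and the quadratic form of `R` reduce to weighted sums. -/
theorem R_eq_diagonal : S.R = diagonal fun n => (S.weight n : ℂ) := by
  ext i j
  rcases eq_or_ne i j with rfl | hij
  · simp [R, H, weight, Matrix.sum_apply, diagonal_conjTranspose, Complex.conj_mul']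
  · simp [R, H, Matrix.sum_apply, diagonal_conjTranspose, hij]

theorem trR_eq : S.trR = ∑ n, S.weight n := by
  simp [trR, R_eq_diagonal, trace_diagonal]

theorem re_star_dotProduct_R (u v : EuclideanSpace ℂ (Fin N)) :
    (star u.ofLp ⬝ᵥ (S.R *ᵥ v.ofLp)).re = weightedForm S.weight u v := by
  rw [R_eq_diagonal, weightedForm_apply, dotProduct, Complex.re_sum]
  refine Finset.sum_congr rfl fun n _ => ?_
  simp [mulVec_diagonal]
  ring

theorem hermForm_R (v : EuclideanSpace ℂ (Fin N)) :
    hermForm S.R v.ofLp = weightedForm S.weight v v :=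
  S.re_star_dotProduct_R v v

theorem trRγ_eq (v : EuclideanSpace ℂ (Fin N)) : S.trRγ v = weightedForm S.weight v v := by
  rw [← re_star_dotProduct_R, trRγ, mul_vecMulVec, trace_vecMulVec, dotProduct_comm]

theorem hermForm_RE (v : Fin N → ℂ) :
    hermForm S.RE v = ‖star S.gHat ⬝ᵥ v‖ ^ 2 + S.varG * ∑ n, ‖v n‖ ^ 2 := by
  rw [RE, hermForm_add, hermForm_smul, hermForm_one, hermForm_vecMulVec]

theorem isPSDQuadratic_gainB (k m : Fin K) : IsPSDQuadratic (S.gainB k m) := by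
  unfold gainB
  simp only [dotProduct_mulVec]
  exact isPSDQuadratic_norm_dotProduct_sq _

theorem isPSDQuadratic_gainE (hG : 0 ≤ S.varG) (m : Fin K) : IsPSDQuadratic (S.gainE m) := by
  unfold gainE
  simp only [hermForm_RE, dotProduct_mulVec]
  refine (isPSDQuadratic_norm_dotProduct_sq _).add (IsPSDQuadratic.const_mul ?_ hG)
  simp only [H, mulVec_diagonal, norm_mul, mul_pow]
  exact isPSDQuadratic_weighted fun n => sq_nonneg _

theorem isPSDQuadratic_hermForm_RE (hG : 0 ≤ S.varG) :
    IsPSDQuadratic fun v : EuclideanSpace ℂ (Fin N) => hermForm S.RE v.ofLp := by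
  simp only [hermForm_RE]
  refine (isPSDQuadratic_norm_dotProduct_sq _).add (IsPSDQuadratic.const_mul ?_ hG)
  simpa using isPSDQuadratic_weighted (N := N) (r := fun _ => 1) fun _ => zero_le_one

/-- The amplified noise is `‖Γᴴ Gᴴ c‖²`, and the diagonal `Γ` acts coordinatewise; this makes it
quadratic in `γ`. -/
theorem hermForm_WB (v : EuclideanSpace ℂ (Fin N)) (c : Fin NB → ℂ) :
    hermForm (S.WB v) c = S.varB * (∑ i, ‖c i‖ ^ 2) +
      S.varRIS * ∑ n, ‖(S.Gᴴ *ᵥ c) n‖ ^ 2 * ‖v n‖ ^ 2 := by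
  have h : S.G * diagonal v.ofLp * (diagonal v.ofLp)ᴴ * S.Gᴴ =
      (S.G * diagonal v.ofLp) * (S.G * diagonal v.ofLp)ᴴ := by
    rw [conjTranspose_mul, Matrix.mul_assoc]
  rw [WB, hermForm_add, hermForm_smul, hermForm_smul, hermForm_one, h, hermForm_mul_conjTranspose]
  congr 2
  refine Finset.sum_congr rfl fun n _ => ?_
  rw [conjTranspose_mul, ← mulVec_mulVec, diagonal_conjTranspose, mulVec_diagonal, norm_mul,
    mul_pow, mul_comm]
  simp

theorem sinrB_eq (k : Fin K) (v : EuclideanSpace ℂ (Fin N)) :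
    S.sinrB k v = S.xB k v / S.yB k v := by
  rw [sinrB, xB, yB, hermForm_WB]

theorem isConcaveMinorant_bob (hp : ∀ k, 0 ≤ S.p k) (hvarB : 0 < S.varB) (hvarRIS : 0 < S.varRIS)
    (k : Fin K) :
    IsConcaveMinorant (fun v => Real.logb 2 (1 + S.xB k v / S.yB k v))
      (logRatioMinorant (S.xB k) (S.yB k)) := by
  by_cases hc : S.c k = 0
  · refine isConcaveMinorant_logRatioMinorant_of_eq_zero (fun v => ?_) _
    simp [xB, gainB, hc]
  · obtain ⟨i, hi⟩ := Function.ne_iff.1 hc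
    have hpos : 0 < S.varB * ∑ i, ‖S.c k i‖ ^ 2 :=
      mul_pos hvarB <| Finset.sum_pos' (fun _ _ => sq_nonneg _)
        ⟨i, Finset.mem_univ _, pow_pos (norm_pos_iff.2 hi) 2⟩
    refine isConcaveMinorant_logRatioMinorant ((S.isPSDQuadratic_gainB k k).const_mul (hp k))
      hpos ?_
    simp only [yB, add_assoc, add_sub_cancel_left]
    exact ((isPSDQuadratic_weighted fun n => sq_nonneg _).const_mul hvarRIS.le).add
      (.sum _ fun m => (S.isPSDQuadratic_gainB k m).const_mul (hp m))

theorem isPSDQuadratic_xE (hp : ∀ k, 0 ≤ S.p k) (hG : 0 ≤ S.varG) (k : Fin K) :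
    IsPSDQuadratic (S.xE k) :=
  (S.isPSDQuadratic_gainE hG k).const_mul (hp k)

theorem isPSDQuadratic_yE (hp : ∀ k, 0 ≤ S.p k) (hvarRIS : 0 < S.varRIS) (hG : 0 ≤ S.varG)
    (k : Fin K) : IsPSDQuadratic (S.yE k) :=
  (IsPSDQuadratic.sum _ fun m => (S.isPSDQuadratic_gainE hG m).const_mul (hp m)).add
    ((S.isPSDQuadratic_hermForm_RE hG).const_mul hvarRIS.le)

/-- The approximate secrecy rate of user `k`. -/
def secrecyRate (k : Fin K) (v : EuclideanSpace ℂ (Fin N)) : ℝ :=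
  Real.logb 2 (1 + S.sinrB k v) - Real.logb 2 (1 + S.sinrE k v)

/-- Eve's rate splits: `-log₂ (1 + x_E / (y_E + σ_E²))` is `log₂ (1 + y_E / σ_E²)` plus `log₂ (σ_E²
/ (σ_E² + x_E + y_E))`, and each summand has its own minorant. -/
theorem isConcaveMinorant_surrogateRate (hp : ∀ k, 0 ≤ S.p k) (hvarB : 0 < S.varB)
    (hvarE : 0 < S.varE) (hvarRIS : 0 < S.varRIS) (hG : 0 ≤ S.varG) (k : Fin K) :
    IsConcaveMinorant (S.secrecyRate k) (S.surrogateRate k) := by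
  have hx := S.isPSDQuadratic_xE hp hG k
  have hy := S.isPSDQuadratic_yE hp hvarRIS hG k
  have hE : IsConcaveMinorant (fun v => Real.logb 2 (1 + S.yE k v / S.varE))
      (logRatioMinorant (S.yE k) fun _ => S.varE) :=
    isConcaveMinorant_logRatioMinorant hy hvarE (by simpa using isPSDQuadratic_zero)
  have h := ((S.isConcaveMinorant_bob hp hvarB hvarRIS k).add hE).add
    (isConcaveMinorant_logb_div hx hy hvarE)
  have e : S.secrecyRate k = fun v => Real.logb 2 (1 + S.xB k v / S.yB k v) +
      Real.logb 2 (1 + S.yE k v / S.varE) +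
        Real.logb 2 (S.varE / (S.varE + S.xE k v + S.yE k v)) := by
    ext v
    have hx0 := hx.nonneg v
    have hy0 := hy.nonneg v
    rw [secrecyRate, sinrB_eq, show S.sinrE k v = S.xE k v / (S.yE k v + S.varE) from rfl,
      sub_eq_add_neg, add_assoc]
    congr 1
    rw [← Real.logb_inv, ← Real.logb_mul (by positivity) (by positivity)]
    congr 1
    field_simp
    ring
  rw [e]
  exact h

theorem varRIS_le_weight (hp : ∀ k, 0 ≤ S.p k) (n : Fin N) :
    S.varRIS ≤ S.weight n :=
  le_add_of_nonneg_left (Finset.sum_nonneg fun k _ => mul_nonneg (hp k) (sq_nonneg _))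

/-- The RIS subproblem and its surrogates. -/
def surrogateModel (hB : 0 < S.B) (hp : ∀ k, 0 ≤ S.p k) (hmu : ∀ k, 0 ≤ S.mu k)
    (hvarB : 0 < S.varB) (hvarE : 0 < S.varE) (hvarRIS : 0 < S.varRIS) (hvarG : 0 ≤ S.varG)
    (hPc : 0 < S.Pc) (hPRmax : 0 < S.PRmax) : SurrogateModel (EuclideanSpace ℂ (Fin N)) where
  B := S.B
  C := S.Pceq
  τ := S.trR
  P := S.PRmax
  m := S.varRIS
  quad := S.trRγ
  rate v := ∑ k, S.secrecyRate k v
  minor v₀ v := ∑ k, S.surrogateRate k v₀ v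
  form := weightedForm S.weight
  B_pos := hB
  power_pos := by
    -- In `τ + C` the two traces of `R` cancel.
    have := Finset.sum_nonneg fun k (_ : k ∈ Finset.univ) => mul_nonneg (hp k) (hmu k)
    rw [Pceq]
    linarith
  P_pos := hPRmax
  m_pos := hvarRIS
  psd := isPSDForm_weightedForm fun n => hvarRIS.le.trans (S.varRIS_le_weight hp n)
  quad_eq := S.trRγ_eq
  coercive v := by
    rw [trRγ_eq, weightedForm_self, EuclideanSpace.norm_sq_eq, Finset.mul_sum]
    exact Finset.sum_le_sum fun n _ =>
      mul_le_mul_of_nonneg_right (S.varRIS_le_weight hp n) (sq_nonneg _)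
  pos_or_subsingleton := by
    -- Without reflecting elements `tr(R) = 0`, but then the space is trivial.
    rcases isEmpty_or_nonempty (Fin N) with h | h
    · exact .inr inferInstance
    · left
      rw [trR_eq]
      exact Finset.sum_pos (fun n _ => hvarRIS.trans_le (S.varRIS_le_weight hp n))
        Finset.univ_nonempty
  minorant := .sum _ (S.isConcaveMinorant_surrogateRate hp hvarB hvarE hvarRIS hvarG)

theorem exists_isFeasible (hPRmax : 0 < S.PRmax) : ∃ v, S.IsFeasible v := by
  -- Unit-modulus reflection leaves the power unchanged and meets the lower constraint with
  -- equality.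
  have h : S.trRγ (WithLp.toLp 2 fun _ => 1) = S.trR := by
    rw [trRγ_eq, weightedForm_self, trR_eq]
    simp
  exact ⟨_, h.ge, by linarith⟩

theorem isSurrogateSolution_iff (hB : 0 < S.B) (hp : ∀ k, 0 ≤ S.p k) (hmu : ∀ k, 0 ≤ S.mu k)
    (hvarB : 0 < S.varB) (hvarE : 0 < S.varE) (hvarRIS : 0 < S.varRIS) (hvarG : 0 ≤ S.varG)
    (hPc : 0 < S.Pc) (hPRmax : 0 < S.PRmax) (v₀ v : EuclideanSpace ℂ (Fin N)) :
    (S.surrogateModel hB hp hmu hvarB hvarE hvarRIS hvarG hPc hPRmax).IsSurSolution v₀ v ↔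
      S.IsSurrogateSolution v₀ v := by
  have h : ∀ w, (S.surrogateModel hB hp hmu hvarB hvarE hvarRIS hvarG hPc hPRmax).IsSurFeasible
      v₀ w ↔ S.IsSurrogateFeasible v₀ w := fun w => by
    simp only [SurrogateModel.IsSurFeasible, IsSurrogateFeasible, re_star_dotProduct_R, hermForm_R,
      surrogateModel, trRγ_eq]
  simp only [SurrogateModel.IsSurSolution, IsSurrogateSolution, h]
  rfl

end RISNetwork

end

theorem proposition1 {K N NB : ℕ} (S : RISNetwork K N NB)
    (hB : 0 < S.B) (hp : ∀ k, 0 ≤ S.p k) (hmu : ∀ k, 0 ≤ S.mu k)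
    (hvarB : 0 < S.varB) (hvarE : 0 < S.varE) (hvarRIS : 0 < S.varRIS) (hvarG : 0 ≤ S.varG)
    (hPc : 0 < S.Pc) (hPRmax : 0 < S.PRmax) :
    -- the algorithm can be started, and each of its steps can be carried out
    (∃ γ₀, S.IsFeasible γ₀) ∧
    (∀ γ₀, S.IsFeasible γ₀ → ∃ γ, S.IsSurrogateSolution γ₀ γ) ∧
    ∀ γ : ℕ → EuclideanSpace ℂ (Fin N), S.IsRun γ →
      -- the iterates are feasible
      (∀ n, S.IsFeasible (γ n)) ∧
      -- the objective improves monotonically, strictly as long as no KKT point is reached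
      Monotone (fun n => S.see (γ n)) ∧
      (∀ n, ¬ S.IsKKT (γ n) → S.see (γ n) < S.see (γ (n + 1))) ∧
      -- the objective converges, and limit points of the iterates are KKT points
      (∃ L : ℝ, Tendsto (fun n => S.see (γ n)) atTop (𝓝 L) ∧
        (∃ x, MapClusterPt x atTop γ) ∧
        ∀ x, MapClusterPt x atTop γ → S.IsKKT x ∧ S.see x = L) ∧
      -- the iterates approach the set of KKT points
      (∀ δ > 0, ∀ᶠ n in atTop, ∃ x, S.IsKKT x ∧ ‖γ n - x‖ < δ) ∧
      -- the output of the algorithm approaches the set of KKT points as the tolerance decreases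
      (∀ δ > 0, ∃ ε₀ > 0, ∀ ε ≤ ε₀, ∀ n, StopsAt γ ε n →
        ∃ x, S.IsKKT x ∧ ‖γ (n + 1) - x‖ < δ) ∧
      -- if a positive secrecy rate is reached, the steps vanish and the algorithm terminates
      ((∃ n, 0 < S.see (γ n)) →
        Tendsto (fun n => ‖γ (n + 1) - γ n‖) atTop (𝓝 0) ∧
        ∀ ε > 0, ∃ n, StopsAt γ ε n) := by
  set M := S.surrogateModel hB hp hmu hvarB hvarE hvarRIS hvarG hPc hPRmax
  have hiff := S.isSurrogateSolution_iff hB hp hmu hvarB hvarE hvarRIS hvarG hPc hPRmax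
  refine ⟨S.exists_isFeasible hPRmax, fun γ₀ h => ?_, fun γ hγ => ?_⟩
  · obtain ⟨v, hv⟩ := SurrogateModel.IsFeasible.exists_isSurSolution (M := M) h
    exact ⟨v, (hiff _ _).1 hv⟩
  · have hrun : M.IsRun γ := ⟨hγ.1, fun n => (hiff _ _).2 (hγ.2 n)⟩
    obtain ⟨L, hL⟩ := hrun.exists_tendsto_obj
    exact ⟨hrun.isFeasible, hrun.monotone_obj, hrun.obj_lt,
      ⟨L, hL, hrun.exists_mapClusterPt, fun x hx =>
        ⟨hrun.isKKT_of_mapClusterPt hx, hrun.obj_eq_of_mapClusterPt hL hx⟩⟩,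
      fun δ hδ => hrun.eventually_exists_isKKT hδ, fun δ hδ => hrun.exists_tolerance hδ,
      fun hpos => ⟨hrun.tendsto_norm_step hpos,
        fun ε hε => exists_stopsAt (hrun.tendsto_norm_step hpos) hε⟩⟩
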